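/- Let $n\ge 1$ and let $\Sigma_n=\{1,2,\dots,n\}$. Let $P_n$ be the language of all words over $\Sigma_n$ that are permutations of $\Sigma_n$, that is, in which every letter of $\Sigma_n$ occurs exactly once. Regular expressions over $\Sigma_n$ are built from $\emptyset$, $\varepsilon$ and the letters of $\Sigma_n$ by union ($+$), concatenation and Kleene star; the alphabetic length of a regular expression is the number of occurrences of letters of $\Sigma_n$ in it. For a nonempty finite alphabet $S$ define the divide-and-conquer regular expression $E(S)$ recursively by $E(\{i\})=i$ and $$E(S)=\sum_{T\subseteq S,\ |T|=\lfloor |S|/2\rfloor} (E(T))(E(S-T))\qquad\text{for } |S|\ge 2,$$ where the sum denotes the union, taken over the sets $T$ in colexicographic order, and let $R_n=E(\Sigma_n)$. Define $f(1)=1$ and $$f(n)=\binom{n}{\lfloor n/2\rfloor}\bigl(f(\lfloor n/2\rfloor)+f(\lceil n/2\rceil)\bigr)\qquad\text{for } n>1.$$ Then $R_n$ specifies $P_n$, the alphabetic length of $R_n$ is $f(n)$, and every regular expression over $\Sigma_n$ that specifies $P_n$ has alphabetic length at least that of $R_n$. Hence the minimum alphabetic length of a regular expression specifying $P_n$ is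 $f(n)$, and $R_n$ attains it. -/

import Mathlib

namespace PermLang

/-- The alphabetic length of a regular expression: the number of occurrences of alphabet symbols
(all other symbols, such as parentheses, `+`, `∗`, `ε` and `∅`, are ignored). -/
def alphabeticLength {α : Type*} : RegularExpression α → ℕ
  | .zero => 0
  | .epsilon => 0
  | .char _ => 1
  | .plus r s => alphabeticLength r + alphabeticLength s
  | .comp r s => alphabeticLength r + alphabeticLength s
  | .star r => alphabeticLength r

/-- The permutation language `P_n`: all words that are permutations of the alphabet with `n`
letters. -/
def permLanguage (n : ℕ) : Language (Fin n) :=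
  {w | w.Perm (List.finRange n)}

/-- The union `r₁ + (r₂ + (⋯ + r_m))` of a list of regular expressions, in the given order. -/
def unionList {α : Type*} : List (RegularExpression α) → RegularExpression α
  | [] => 0
  | [r] => r
  | r :: s :: l => r + unionList (s :: l)

/-- The subsets of `S` of cardinality `⌊|S| / 2⌋`, listed in colexicographic order
(for `S = {1, 2, 3, 4}`: `12, 13, 23, 14, 24, 34`). -/
def halves {α : Type*} [LinearOrder α] (S : Finset α) : List (Finset α) :=
  (((S.powersetCard (S.card / 2)).map (toColex (α := Finset α)).toEmbedding).sort (· ≤ ·)).map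
    ofColex

theorem mem_halves {α : Type*} [LinearOrder α] {S T : Finset α} :
    T ∈ halves S ↔ T ⊆ S ∧ T.card = S.card / 2 := by
  simp [halves, Finset.mem_powersetCard]

/-- The divide-and-conquer expression `E(S)` for the permutations of the letters of `S`:
`E({i}) = i`, and `E(S)` is the union of the `E(T) E(S - T)` over all `T ⊆ S` with
`|T| = ⌊|S| / 2⌋` when `|S| ≥ 2`. (The empty alphabet, which plays no role, is sent to `ε`.) -/
def divideConquer {α : Type*} [LinearOrder α] (S : Finset α) : RegularExpression α :=
  if h₀ : S.card = 0 then 1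
  else if h₁ : S.card = 1 then
    .char (S.min' (Finset.card_pos.mp (by omega)))
  else
    unionList ((halves S).attach.map fun T => divideConquer T.1 * divideConquer (S \ T.1))
termination_by S.card
decreasing_by
  all_goals
    obtain ⟨hT, hc⟩ := mem_halves.mp T.2
    first
      | omega
      | (rw [Finset.card_sdiff_of_subset hT]; omega)

/-- The regular expression `R_n = E(Σ_n)`. -/
def R (n : ℕ) : RegularExpression (Fin n) :=
  divideConquer Finset.univ

/-- `f(1) = 1` and `f(n) = C(n, ⌊n/2⌋) (f(⌊n/2⌋) + f(⌈n/2⌉))` for `n > 1`; the value at `0` plays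
no role. Here `(n + 1) / 2` is `⌈n/2⌉`. -/
def f (n : ℕ) : ℕ :=
  if n = 0 then 0
  else if n = 1 then 1
  else n.choose (n / 2) * (f (n / 2) + f ((n + 1) / 2))
termination_by n
decreasing_by all_goals omega

end PermLang

/-! The lower bound counts words per letter. If all words of an expression are rearrangements of one
word of length `n`, the expression specifies at most `n! / f n` words per occurrence of a letter
(`ncard_matches'_mul_f_le`); since `P_n` has `n!` words, its expressions have length at least `f n`.
The bound goes by induction on the expression, and only concatenation uses more than additivity:
nonempty factors again consist of rearrangements of fixed words, of lengths `k` and `m`, and the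
count closes by `f (k + m) ≤ C(k + m, k) (f k + f m)` (`f_add_le`). That inequality rests on
`f_le_choose_mul`, which even drops the smaller term `f k`. -/

namespace PermLang

/-! ### Growth of `f` and optimality of halving. -/

section Arithmetic

theorem f_zero : f 0 = 0 := by rw [f]; simp

theorem f_one : f 1 = 1 := by rw [f]; simp

theorem f_two_mul {h : ℕ} (hh : 1 ≤ h) : f (2 * h) = (2 * h).choose h * (2 * f h) := by
  rw [f, if_neg (by omega), if_neg (by omega), show 2 * h / 2 = h by omega,
    show (2 * h + 1) / 2 = h by omega, two_mul (f h)]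

theorem f_two_mul_add_one {h : ℕ} (hh : 1 ≤ h) :
    f (2 * h + 1) = (2 * h + 1).choose h * (f h + f (h + 1)) := by
  rw [f, if_neg (by omega), if_neg (by omega), show (2 * h + 1) / 2 = h by omega,
    show (2 * h + 1 + 1) / 2 = h + 1 by omega]

theorem f_of_two_le {n : ℕ} (hn : 2 ≤ n) :
    f n = n.choose (n / 2) * (f (n / 2) + f (n - n / 2)) := by
  rw [f, if_neg (by omega), if_neg (by omega), show (n + 1) / 2 = n - n / 2 by omega]

/-- The function `f` grows at least by a factor of `3` at each step. -/
theorem three_mul_f_le (m : ℕ) : 3 * f m ≤ f (m + 1) := by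
  induction m using Nat.strong_induction_on with
  | _ m ih =>
  rcases Nat.eq_zero_or_pos m with rfl | hm
  · simp [f_zero]
  rcases Nat.even_or_odd' m with ⟨j, rfl | rfl⟩
  · have hj : 1 ≤ j := by omega
    rw [f_two_mul hj, f_two_mul_add_one hj]
    have ihj := ih j (by omega)
    have hc : (2 * j + 1) * (2 * j).choose j = (2 * j + 1).choose j * (j + 1) := by
      have := Nat.add_one_mul_choose_eq (2 * j) j
      rw [this, ← Nat.choose_symm_half]
    have hpos : 0 < j + 1 := by omega
    refine Nat.le_of_mul_le_mul_left ?_ hpos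
    calc (j + 1) * (3 * ((2 * j).choose j * (2 * f j)))
        = (2 * j).choose j * f j * (6 * (j + 1)) := by ring
      _ ≤ (2 * j).choose j * f j * (4 * (2 * j + 1)) := Nat.mul_le_mul_left _ (by omega)
      _ = ((2 * j + 1) * (2 * j).choose j) * (f j + 3 * f j) := by ring
      _ ≤ ((2 * j + 1) * (2 * j).choose j) * (f j + f (j + 1)) := by gcongr
      _ = _ := by rw [hc]; ring
  · rcases Nat.eq_zero_or_pos j with rfl | hj
    · have := f_two_mul (h := 1) le_rfl
      simp [f_one] at this ⊢
      omega
    rw [f_two_mul_add_one hj, show 2 * j + 1 + 1 = 2 * (j + 1) by ring, f_two_mul (by omega)]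
    have ihj := ih j (by omega)
    have hc : (2 * (j + 1)).choose (j + 1) = 2 * (2 * j + 1).choose j := by
      rw [show 2 * (j + 1) = (2 * j + 1) + 1 by ring, Nat.choose_succ_succ, Nat.choose_symm_half]
      ring
    rw [hc]
    calc 3 * ((2 * j + 1).choose j * (f j + f (j + 1)))
        = (2 * j + 1).choose j * (3 * f j + 3 * f (j + 1)) := by ring
      _ ≤ (2 * j + 1).choose j * (f (j + 1) + 3 * f (j + 1)) := by gcongr
      _ = _ := by ring

/-- The bound `f n ≤ C(n, k) f (n - k)` for the `k` nearest to `n / 2`. -/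
theorem f_le_choose_mul_near_half {n k : ℕ} (h₁ : 2 * k + 2 ≤ n) (h₂ : n ≤ 2 * k + 3) :
    f n ≤ n.choose k * f (n - k) := by
  rcases Nat.eq_zero_or_pos k with rfl | hk
  · simp
  have hc := Nat.choose_succ_right_eq n k
  rcases (show n = 2 * (k + 1) ∨ n = 2 * (k + 1) + 1 by omega) with rfl | rfl
  · rw [f_two_mul (by omega), show 2 * (k + 1) - k = k + 1 + 1 by omega]
    rw [show 2 * (k + 1) - k = k + 2 by omega] at hc
    have h3 := three_mul_f_le (k + 1)
    refine Nat.le_of_mul_le_mul_left ?_ (show 0 < k + 1 by omega)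
    calc (k + 1) * ((2 * (k + 1)).choose (k + 1) * (2 * f (k + 1)))
        = ((2 * (k + 1)).choose (k + 1) * (k + 1)) * (2 * f (k + 1)) := by ring
      _ = (2 * (k + 1)).choose k * f (k + 1) * (2 * (k + 2)) := by rw [hc]; ring
      _ ≤ (2 * (k + 1)).choose k * f (k + 1) * (3 * (k + 1)) := Nat.mul_le_mul_left _ (by omega)
      _ = (k + 1) * ((2 * (k + 1)).choose k * (3 * f (k + 1))) := by ring
      _ ≤ _ := by gcongr
  · rw [f_two_mul_add_one (by omega), show 2 * (k + 1) + 1 - k = k + 1 + 1 + 1 by omega]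
    rw [show 2 * (k + 1) + 1 - k = k + 3 by omega] at hc
    have h3 := three_mul_f_le (k + 1)
    have h4 := three_mul_f_le (k + 1 + 1)
    have h5 : (k + 3) * (f (k + 1) + f (k + 1 + 1)) ≤ (k + 1) * f (k + 1 + 1 + 1) := by
      have : (k + 3) * (3 * f (k + 1) + 3 * f (k + 1 + 1)) ≤ (k + 1) * (9 * f (k + 1 + 1)) :=
        calc (k + 3) * (3 * f (k + 1) + 3 * f (k + 1 + 1))
            ≤ (k + 3) * (f (k + 1 + 1) + 3 * f (k + 1 + 1)) := by gcongr
          _ = f (k + 1 + 1) * (4 * (k + 3)) := by ring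
          _ ≤ f (k + 1 + 1) * (9 * (k + 1)) := Nat.mul_le_mul_left _ (by omega)
          _ = _ := by ring
      have h6 : (k + 1) * (3 * f (k + 1 + 1)) ≤ (k + 1) * f (k + 1 + 1 + 1) := by gcongr
      linarith
    refine Nat.le_of_mul_le_mul_left ?_ (show 0 < k + 1 by omega)
    calc (k + 1) * ((2 * (k + 1) + 1).choose (k + 1) * (f (k + 1) + f (k + 1 + 1)))
        = ((2 * (k + 1) + 1).choose (k + 1) * (k + 1)) * (f (k + 1) + f (k + 1 + 1)) := by ring
      _ = (2 * (k + 1) + 1).choose k * ((k + 3) * (f (k + 1) + f (k + 1 + 1))) := by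
        rw [hc]; ring
      _ ≤ (2 * (k + 1) + 1).choose k * ((k + 1) * f (k + 1 + 1 + 1)) := by gcongr
      _ = _ := by ring

/-- The bound `f n ≤ C(n, k) f (n - k)` for `k` between `n / 4` and `n / 2`. -/
theorem f_le_choose_mul_of_le {n k : ℕ} (h₁ : 2 * k + 2 ≤ n) (h₂ : n ≤ 4 * k + 3) :
    f n ≤ n.choose k * f (n - k) := by
  by_cases h : n ≤ 2 * k + 3
  · exact f_le_choose_mul_near_half h₁ h
  refine (f_le_choose_mul_of_le (k := k + 1) (by omega) (by omega)).trans ?_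
  have hc := Nat.choose_succ_right_eq n k
  have h3 := three_mul_f_le (n - (k + 1))
  rw [show n - (k + 1) + 1 = n - k by omega] at h3
  refine Nat.le_of_mul_le_mul_left ?_ (show 0 < k + 1 by omega)
  calc (k + 1) * (n.choose (k + 1) * f (n - (k + 1)))
      = (n.choose (k + 1) * (k + 1)) * f (n - (k + 1)) := by ring
    _ = n.choose k * f (n - (k + 1)) * (n - k) := by rw [hc]; ring
    -- `n ≤ 4k + 3` says exactly that `C(n, k + 1) / C(n, k) = (n - k) / (k + 1)` is at most the
    -- growth factor `3`.
    _ ≤ n.choose k * f (n - (k + 1)) * (3 * (k + 1)) := Nat.mul_le_mul_left _ (by omega)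
    _ = (k + 1) * (n.choose k * (3 * f (n - (k + 1)))) := by ring
    _ ≤ _ := by gcongr
termination_by n - 2 * k

theorem add_choose_mul_factorials (i j : ℕ) :
    (i + j).choose i * i.factorial * j.factorial = (i + j).factorial := by
  rw [Nat.choose_symm_add, Nat.add_choose_mul_factorial_mul_factorial]

/-- Two ways to count the partitions into blocks of sizes `a`, `b`, `c`, `d`. -/
theorem choose_mul_choose_mul_choose (a b c d : ℕ) :
    (a + b + (c + d)).choose (a + b) * (a + b).choose a * (c + d).choose c =
      (a + c + (b + d)).choose (a + c) * (b + d).choose b * (a + c).choose a := by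
  have h1 := add_choose_mul_factorials (a + b) (c + d)
  have h2 := add_choose_mul_factorials a b
  have h3 := add_choose_mul_factorials c d
  have h4 := add_choose_mul_factorials (a + c) (b + d)
  have h5 := add_choose_mul_factorials a c
  have h6 := add_choose_mul_factorials b d
  have hpos : 0 < a.factorial * b.factorial * c.factorial * d.factorial := by positivity
  refine Nat.eq_of_mul_eq_mul_right hpos ?_
  rw [← h2, ← h3] at h1
  rw [← h5, ← h6, show a + c + (b + d) = a + b + (c + d) by ring] at h4
  rw [show a + c + (b + d) = a + b + (c + d) by ring]
  linarith

/-- In the double count above, `C(a + c, a) ≤ C(c + d, c)` because `a ≤ d`; cancel the former. -/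
theorem choose_mul_choose_le {a b c d : ℕ} (h : a ≤ d) :
    (a + b + (c + d)).choose (a + b) * (a + b).choose a ≤
      (a + c + (b + d)).choose (a + c) * (b + d).choose b := by
  refine Nat.le_of_mul_le_mul_right ?_ (Nat.choose_pos (Nat.le_add_right a c))
  rw [← choose_mul_choose_mul_choose]
  refine Nat.mul_le_mul_left _ ?_
  rw [Nat.choose_symm_add]
  exact Nat.choose_le_choose c (by omega)

/-- For `n ≥ 4k + 4`, halve both `n` and `n - k`. The halves differ by `k₁` and `k₂` with `k₁ + k₂ =
k`, induction applies to each half of `n`, and `choose_mul_choose_le` compares the binomials. -/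
theorem f_le_choose_mul (n k : ℕ) (hk : 2 * k + 2 ≤ n) : f n ≤ n.choose k * f (n - k) := by
  induction n using Nat.strong_induction_on generalizing k with
  | _ n ih =>
  by_cases hn : n ≤ 4 * k + 3
  · exact f_le_choose_mul_of_le hk hn
  rcases Nat.eq_zero_or_pos k with rfl | hk0
  · simp
  obtain ⟨a, ha⟩ : ∃ a, a = (n - k) / 2 := ⟨_, rfl⟩
  obtain ⟨b, hb⟩ : ∃ b, b = n - k - a := ⟨_, rfl⟩
  obtain ⟨k₁, hk₁⟩ : ∃ k₁, k₁ = n / 2 - a := ⟨_, rfl⟩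
  obtain ⟨k₂, hk₂⟩ : ∃ k₂, k₂ = k - k₁ := ⟨_, rfl⟩
  have ih₁ := ih (n / 2) (by omega) k₁ (by omega)
  have ih₂ := ih (n - n / 2) (by omega) k₂ (by omega)
  rw [show n / 2 - k₁ = a by omega] at ih₁
  rw [show n - n / 2 - k₂ = b by omega] at ih₂
  have c₁ := choose_mul_choose_le (a := k₁) (b := a) (c := k₂) (d := b) (by omega)
  have c₂ := choose_mul_choose_le (a := k₂) (b := b) (c := k₁) (d := a) (by omega)
  rw [show k₁ + a + (k₂ + b) = n by omega, show k₁ + a = n / 2 by omega,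
    show k₁ + k₂ + (a + b) = n by omega, show k₁ + k₂ = k by omega,
    show a + b = n - k by omega] at c₁
  rw [show k₂ + b + (k₁ + a) = n by omega, show k₂ + b = n - n / 2 by omega,
    show k₂ + k₁ + (b + a) = n by omega, show k₂ + k₁ = k by omega,
    show b + a = n - k by omega, Nat.choose_symm (by omega),
    Nat.choose_symm_of_eq_add (show n - k = b + a by omega)] at c₂
  rw [f_of_two_le (show 2 ≤ n by omega), f_of_two_le (show 2 ≤ n - k by omega), ← ha, ← hb]
  calc n.choose (n / 2) * (f (n / 2) + f (n - n / 2))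
      ≤ n.choose (n / 2) * ((n / 2).choose k₁ * f a + (n - n / 2).choose k₂ * f b) := by gcongr
    _ = n.choose (n / 2) * (n / 2).choose k₁ * f a +
        n.choose (n / 2) * (n - n / 2).choose k₂ * f b := by ring
    _ ≤ n.choose k * (n - k).choose a * f a + n.choose k * (n - k).choose a * f b := by gcongr
    _ = _ := by ring

/-- Splitting in halves is optimal. -/
theorem f_add_le (k m : ℕ) : f (k + m) ≤ (k + m).choose k * (f k + f m) := by
  wlog h : k ≤ m generalizing k m
  · have := this m k (by omega)
    rwa [add_comm m k, ← Nat.choose_symm_add, add_comm (f m)] at this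
  by_cases h2 : 2 * k + 2 ≤ k + m
  · have := f_le_choose_mul (k + m) k h2
    rw [Nat.add_sub_cancel_left] at this
    exact this.trans (by gcongr; omega)
  -- Only `m = k` and `m = k + 1` remain; for `k ≥ 1` this is the recursion of `f`.
  rcases Nat.eq_zero_or_pos k with rfl | hk
  · simp [f_zero]
  · rw [f_of_two_le (by omega), show (k + m) / 2 = k by omega, Nat.add_sub_cancel_left]

end Arithmetic

/-! ### Words per letter and the lower bound. -/

section LowerBound

variable {α : Type*}

theorem finite_of_perm {L : Language α} {w₀ : List α} (h : ∀ w ∈ L, w.Perm w₀) :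
    {w | w ∈ L}.Finite :=
  (List.finite_toSet w₀.permutations).subset fun w hw => List.mem_permutations.mpr (h w hw)

theorem ncard_le_factorial_of_perm {L : Language α} {w₀ : List α} (h : ∀ w ∈ L, w.Perm w₀) :
    {w | w ∈ L}.ncard ≤ w₀.length.factorial := by
  classical
  have hs : {w | w ∈ L} ⊆ (w₀.permutations.toFinset : Set (List α)) := fun w hw =>
    Finset.mem_coe.mpr (List.mem_toFinset.mpr (List.mem_permutations.mpr (h w hw)))
  have h₁ := Set.ncard_le_ncard hs (Finset.finite_toSet _)
  have h₂ := List.toFinset_card_le w₀.permutations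
  rw [List.length_permutations] at h₂
  rw [Set.ncard_coe_finset] at h₁
  exact h₁.trans h₂

theorem ncard_mul_le (K L : Language α) (hK : {w | w ∈ K}.Finite) (hL : {w | w ∈ L}.Finite) :
    {w | w ∈ K * L}.ncard ≤ {w | w ∈ K}.ncard * {w | w ∈ L}.ncard := by
  have h : {w | w ∈ K * L} =
      (fun p : List α × List α => p.1 ++ p.2) '' ({w | w ∈ K} ×ˢ {w | w ∈ L}) := by
    rw [Set.image_prod]; rfl
  rw [h, ← Set.ncard_prod]
  exact Set.ncard_image_le (hK.prod hL)

/-- An expression all of whose words are rearrangements of one word of length `n` specifies at most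
`n! / f n` words per letter. -/
theorem ncard_matches'_mul_f_le (r : RegularExpression α) (w₀ : List α)
    (h : ∀ w ∈ r.matches', w.Perm w₀) :
    Set.ncard {w | w ∈ r.matches'} * f w₀.length ≤
      alphabeticLength r * w₀.length.factorial := by
  induction r generalizing w₀ with
  | zero =>
    have : {w | w ∈ (RegularExpression.zero : RegularExpression α).matches'} = ∅ := rfl
    rw [this, Set.ncard_empty, zero_mul]
    exact Nat.zero_le _
  | epsilon =>
    -- The empty word forces `w₀` to be empty, and the value `f 0 = 0` makes the left side vanish;
    -- the same happens for a star.
    have := (h [] (Set.mem_singleton _)).length_eq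
    simp [← this, f_zero]
  | char a =>
    have hl := (h [a] (Set.mem_singleton _)).length_eq
    have : {w | w ∈ (RegularExpression.char a).matches'} = {[a]} := rfl
    rw [this, Set.ncard_singleton, ← hl, List.length_singleton, f_one]
    exact le_rfl
  | plus r s ihr ihs =>
    have hr := ihr w₀ fun w hw => h w (Or.inl hw)
    have hs := ihs w₀ fun w hw => h w (Or.inr hw)
    have hu : {w | w ∈ (r.plus s).matches'} =
        {w | w ∈ r.matches'} ∪ {w | w ∈ s.matches'} := rfl
    rw [hu, alphabeticLength, add_mul]
    calc _ ≤ (Set.ncard {w | w ∈ r.matches'} + Set.ncard {w | w ∈ s.matches'}) *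
          f w₀.length := by gcongr; exact Set.ncard_union_le _ _
      _ ≤ _ := by rw [add_mul]; gcongr
  | comp r s ihr ihs =>
    have hm : (r.comp s).matches' = r.matches' * s.matches' := rfl
    rcases Set.eq_empty_or_nonempty {w | w ∈ (r.comp s).matches'} with he | ⟨w, hw⟩
    · rw [he, Set.ncard_empty, zero_mul]
      exact Nat.zero_le _
    obtain ⟨u, hu, v, hv, rfl⟩ := Language.mem_mul.mp (show w ∈ r.matches' * s.matches' from hw)
    have huv := h _ hw
    -- Append the fixed word `v` to `x`, compare with `u ++ v`, and cancel `v`.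
    have hr : ∀ x ∈ r.matches', x.Perm u := fun x hx =>
      (List.perm_append_right_iff v).mp
        ((h _ (Language.append_mem_mul hx hv)).trans huv.symm)
    have hs : ∀ x ∈ s.matches', x.Perm v := fun x hx =>
      (List.perm_append_left_iff u).mp
        ((h _ (Language.append_mem_mul hu hx)).trans huv.symm)
    have hr' := ihr u hr
    have hs' := ihs v hs
    have hl : w₀.length = u.length + v.length := by rw [← huv.length_eq, List.length_append]
    have hra := ncard_le_factorial_of_perm hr
    have hsa := ncard_le_factorial_of_perm hs
    have hab := ncard_mul_le r.matches' s.matches' (finite_of_perm hr) (finite_of_perm hs)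
    have hf := f_add_le u.length v.length
    have hc := add_choose_mul_factorials u.length v.length
    rw [hm, alphabeticLength, hl]
    set a := Set.ncard {w | w ∈ r.matches'}
    set b := Set.ncard {w | w ∈ s.matches'}
    set c := (u.length + v.length).choose u.length
    calc _ ≤ (a * b) * (c * (f u.length + f v.length)) := by gcongr
      _ = c * (b * (a * f u.length) + a * (b * f v.length)) := by ring
      -- The induction bound for each factor is paired with the trivial factorial bound on the words
      -- of the other.
      _ ≤ c * (v.length.factorial * (alphabeticLength r * u.length.factorial) +
          u.length.factorial * (alphabeticLength s * v.length.factorial)) := by gcongr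
      _ = (alphabeticLength r + alphabeticLength s) *
          (c * u.length.factorial * v.length.factorial) := by ring
      _ = _ := by rw [hc]
  | star r _ =>
    have := (h [] (Language.nil_mem_kstar _)).length_eq
    simp [← this, f_zero]

theorem ncard_permLanguage (n : ℕ) :
    {w | w ∈ permLanguage n}.ncard = n.factorial := by
  have h : {w | w ∈ permLanguage n} =
      ((List.finRange n).permutations.toFinset : Set (List (Fin n))) := by
    ext w
    rw [Finset.mem_coe, List.mem_toFinset, List.mem_permutations]
    rfl
  rw [h, Set.ncard_coe_finset, List.toFinset_card_of_nodup
    (List.nodup_permutations _ (List.nodup_finRange n)), List.length_permutations,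
    List.length_finRange]

theorem f_le_alphabeticLength {n : ℕ} (r : RegularExpression (Fin n))
    (hr : r.matches' = permLanguage n) : f n ≤ alphabeticLength r := by
  have h := ncard_matches'_mul_f_le r (List.finRange n) fun w hw => by rwa [hr] at hw
  rw [hr, ncard_permLanguage, List.length_finRange, mul_comm] at h
  exact Nat.le_of_mul_le_mul_right h n.factorial_pos

end LowerBound

/-! ### Language and length of the divide-and-conquer expression. -/

section DivideConquer

theorem mem_matches'_unionList {α : Type*} (l : List (RegularExpression α)) (w : List α) :
    w ∈ (unionList l).matches' ↔ ∃ r ∈ l, w ∈ r.matches' := by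
  induction l with
  | nil => simp [unionList, Language.notMem_zero]
  | cons r l ih =>
    cases l with
    | nil => simp [unionList]
    | cons s l =>
      rw [unionList, RegularExpression.matches'_add, Language.mem_add, ih]
      simp

theorem alphabeticLength_unionList {α : Type*} (l : List (RegularExpression α)) :
    alphabeticLength (unionList l) = (l.map alphabeticLength).sum := by
  induction l with
  | nil => rfl
  | cons r l ih =>
    cases l with
    | nil => simp [unionList]
    | cons s l =>
      rw [unionList, List.map_cons, List.sum_cons, ← ih]
      rfl

variable {α : Type*} [LinearOrder α]

theorem length_halves (S : Finset α) : (halves S).length = S.card.choose (S.card / 2) := by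
  simp [halves]

theorem mem_matches'_divideConquer (S : Finset α) (w : List α) :
    w ∈ (divideConquer S).matches' ↔ w.Nodup ∧ w.toFinset = S := by
  induction hc : S.card using Nat.strong_induction_on generalizing S w with
  | _ n ih =>
  subst hc
  rw [divideConquer]
  split_ifs with h₀ h₁
  · rw [Finset.card_eq_zero] at h₀
    subst h₀
    rw [RegularExpression.matches'_epsilon, Language.mem_one, List.toFinset_eq_empty_iff]
    exact ⟨fun h => by simp [h], And.right⟩
  · obtain ⟨a, rfl⟩ := Finset.card_eq_one.mp h₁
    simp only [Finset.min'_singleton]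
    change w = [a] ↔ _
    refine ⟨fun h => by simp [h], fun ⟨hn, hw⟩ => ?_⟩
    have hl := List.toFinset_card_of_nodup hn
    rw [hw, Finset.card_singleton] at hl
    obtain ⟨b, rfl⟩ := List.length_eq_one_iff.mp hl.symm
    simpa using hw
  · rw [mem_matches'_unionList]
    constructor
    · rintro ⟨r, hr, hw⟩
      obtain ⟨⟨T, hT⟩, -, rfl⟩ := List.mem_map.mp hr
      obtain ⟨hTS, hcT⟩ := mem_halves.mp hT
      have hcd := Finset.card_sdiff_of_subset hTS
      rw [RegularExpression.matches'_mul] at hw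
      obtain ⟨u, hu, v, hv, rfl⟩ := Language.mem_mul.mp hw
      obtain ⟨hu1, hu2⟩ := (ih _ (by omega) T u rfl).mp hu
      obtain ⟨hv1, hv2⟩ := (ih _ (by omega) (S \ T) v rfl).mp hv
      refine ⟨List.nodup_append'.mpr ⟨hu1, hv1, ?_⟩, ?_⟩
      · rw [← List.disjoint_toFinset_iff_disjoint, hu2, hv2]
        exact Finset.disjoint_sdiff
      · rw [List.toFinset_append, hu2, hv2, Finset.union_sdiff_of_subset hTS]
    · rintro ⟨hn, rfl⟩
      -- The summand matching `w` is the one whose `T` is the set of letters in the first half of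
      -- `w`.
      obtain ⟨u, hu⟩ : ∃ u, u = w.take (w.toFinset.card / 2) := ⟨_, rfl⟩
      obtain ⟨v, hv⟩ : ∃ v, v = w.drop (w.toFinset.card / 2) := ⟨_, rfl⟩
      have huv : w = u ++ v := by rw [hu, hv, List.take_append_drop]
      have hlen := List.toFinset_card_of_nodup hn
      have hlu : u.length = w.toFinset.card / 2 := by rw [hu, List.length_take]; omega
      have hn' := hn
      rw [huv] at hn'
      obtain ⟨hu1, hv1, hd⟩ := List.nodup_append'.mp hn'
      have hcu : u.toFinset.card = w.toFinset.card / 2 := by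
        rw [List.toFinset_card_of_nodup hu1, hlu]
      have hsub : u.toFinset ⊆ w.toFinset := by
        rw [huv, List.toFinset_append]; exact Finset.subset_union_left
      have hcd := Finset.card_sdiff_of_subset hsub
      have hv2 : v.toFinset = w.toFinset \ u.toFinset := by
        rw [huv, List.toFinset_append,
          Finset.union_sdiff_cancel_left (List.disjoint_toFinset_iff_disjoint.mpr hd)]
      have hlt₁ : u.toFinset.card < w.toFinset.card := by omega
      have hlt₂ : (w.toFinset \ u.toFinset).card < w.toFinset.card := by omega
      refine ⟨_, List.mem_map.mpr ⟨⟨u.toFinset, mem_halves.mpr ⟨hsub, hcu⟩⟩,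
        List.mem_attach _ _, rfl⟩, ?_⟩
      rw [RegularExpression.matches'_mul]
      refine Language.mem_mul.mpr ⟨u, (ih _ hlt₁ _ u rfl).mpr ⟨hu1, rfl⟩, v,
        (ih _ hlt₂ _ v rfl).mpr ⟨hv1, hv2⟩, huv.symm⟩

theorem alphabeticLength_divideConquer (S : Finset α) :
    alphabeticLength (divideConquer S) = f S.card := by
  induction hc : S.card using Nat.strong_induction_on generalizing S with
  | _ n ih =>
  subst hc
  rw [divideConquer]
  split_ifs with h₀ h₁
  · rw [h₀, f_zero]; rfl
  · rw [h₁, f_one]; rfl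
  · rw [alphabeticLength_unionList, List.map_map, f_of_two_le (by omega), ← length_halves,
      ← List.length_attach, ← smul_eq_mul, ← List.sum_replicate]
    congr 1
    -- All summands have equal length, as by induction it depends only on the sizes of `T` and `S \
    -- T`.
    refine List.eq_replicate_iff.mpr ⟨by simp, fun m hm => ?_⟩
    obtain ⟨⟨T, hT⟩, -, rfl⟩ := List.mem_map.mp hm
    obtain ⟨hTS, hcT⟩ := mem_halves.mp hT
    have hcd := Finset.card_sdiff_of_subset hTS
    change alphabeticLength (divideConquer T) + alphabeticLength (divideConquer (S \ T)) = _
    rw [ih _ (by omega) T rfl, ih _ (by omega) (S \ T) rfl, hcd, hcT]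

theorem matches'_R (n : ℕ) : (R n).matches' = permLanguage n := by
  ext w
  rw [R, mem_matches'_divideConquer]
  change _ ↔ w.Perm (List.finRange n)
  refine ⟨fun ⟨hnd, hw⟩ => ?_, fun h => ⟨h.nodup_iff.mpr (List.nodup_finRange n), ?_⟩⟩
  · refine (List.perm_ext_iff_of_nodup hnd (List.nodup_finRange n)).mpr fun a => ?_
    simp [← List.mem_toFinset, hw]
  · rw [List.toFinset_eq_of_perm _ _ h, List.toFinset_finRange]

theorem alphabeticLength_R (n : ℕ) : alphabeticLength (R n) = f n := by
  rw [R, alphabeticLength_divideConquer, Finset.card_univ, Fintype.card_fin]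

end DivideConquer

end PermLang

theorem theorem3 (n : ℕ) (hn : 1 ≤ n) :
    (PermLang.R n).matches' = PermLang.permLanguage n ∧
    PermLang.alphabeticLength (PermLang.R n) = PermLang.f n ∧
    ∀ r : RegularExpression (Fin n), r.matches' = PermLang.permLanguage n →
      PermLang.alphabeticLength (PermLang.R n) ≤ PermLang.alphabeticLength r := by
  refine ⟨PermLang.matches'_R n, PermLang.alphabeticLength_R n, fun r hr => ?_⟩
  rw [PermLang.alphabeticLength_R]
  exact PermLang.f_le_alphabeticLength r hr
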